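/- Let $\omega^\omega$ be the Baire space, with the product of the discrete topologies on $\omega$. Let $\mathcal{M}$ be the $\sigma$-ideal of meager subsets of $\omega^\omega$. Let $\mathcal{M}_-$ be the family of all sets $F\subseteq\omega^\omega$ for which there are $x_F\in\omega^\omega$ and a partition of $\omega$ into nonempty intervals $(I_n)_{n\in\omega}$ such that $$F\subseteq\{x\in\omega^\omega:\ x\restriction I_n\neq x_F\restriction I_n \text{ for all but finitely many } n\}.$$ For a family $\mathcal{I}$ of subsets of $\omega^\omega$ put $$\mathrm{cov}(\mathcal{I})=\min\{|\mathcal{A}|:\ \mathcal{A}\subseteq\mathcal{I},\ \bigcup\mathcal{A}=\omega^\omega\},\qquad \mathrm{non}(\mathcal{I})=\min\{|A|:\ A\subseteq\omega^\omega,\ A\notin\mathcal{I}\}.$$ Then $$\mathrm{cov}(\mathcal{M}_-)=\mathrm{cov}(\mathcal{M})\quad\text{and}\quad \mathrm{non}(\mathcal{M}_-)=\mathrm{non}(\mathcal{M}).$$ -/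

import Mathlib

open Set Filter
open scoped Cardinal

universe u

/-- The Baire space `ω^ω`; as a topological space it carries the product of the discrete
topologies, which is the topology generated by the sets `[σ] = {x | σ ⊆ x}`. -/
abbrev BairePt : Type := ℕ → ℕ

/-- The covering number of a family `I` of subsets of `X`: the least cardinality of a
subfamily of `I` whose union is `X`. -/
noncomputable def covNumber {X : Type u} (I : Set (Set X)) : Cardinal.{u} :=
  sInf {κ | ∃ A : Set (Set X), A ⊆ I ∧ ⋃₀ A = univ ∧ κ = #A}

/-- The uniformity number of a family `I` of subsets of `X`: the least cardinality of a
subset of `X` that is not in `I`. -/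
noncomputable def nonNumber {X : Type u} (I : Set (Set X)) : Cardinal.{u} :=
  sInf {κ | ∃ A : Set X, A ∉ I ∧ κ = #A}

/-- The ideal `M` of meager subsets of the Baire space. -/
def meagerIdeal : Set (Set BairePt) :=
  {F | IsMeagre F}

/-- `(I n)` is a partition of `ω` into (nonempty) intervals. -/
structure IsIntervalPartition (I : ℕ → Set ℕ) : Prop where
  nonempty : ∀ n, (I n).Nonempty
  interval : ∀ n, (I n).OrdConnected
  disjoint : Pairwise fun m n => Disjoint (I m) (I n)
  cover : ⋃ n, I n = univ

/-- The family `M_-`: the sets `F ⊆ ω^ω` for which there are `z ∈ ω^ω` and a partition of `ω`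
into intervals `I n` such that, for every `x ∈ F`, for all but finitely many `n` the restrictions
of `x` and `z` to `I n` differ (that is, `x` and `z` do not agree on all of `I n`). -/
def meagerMinus : Set (Set BairePt) :=
  {F | ∃ (z : BairePt) (I : ℕ → Set ℕ), IsIntervalPartition I ∧
    F ⊆ {x | ∀ᶠ n in atTop, ¬ EqOn x z (I n)}}

/-- If all singletons are in `I`, the infimum defining `covNumber I` is a minimum. -/
theorem covNumber_isLeast {X : Type u} {I : Set (Set X)} (h : ∀ x, {x} ∈ I) :
    IsLeast {κ | ∃ A : Set (Set X), A ⊆ I ∧ ⋃₀ A = univ ∧ κ = #A} (covNumber I) := by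
  refine ⟨csInf_mem ⟨_, range (fun x : X => ({x} : Set X)), ?_, ?_, rfl⟩,
    fun κ hκ => csInf_le' hκ⟩
  · rintro _ ⟨x, rfl⟩
    exact h x
  · ext x
    simp

/-- If `X` itself is not in `I`, the infimum defining `nonNumber I` is a minimum. -/
theorem nonNumber_isLeast {X : Type u} {I : Set (Set X)} (h : univ ∉ I) :
    IsLeast {κ | ∃ A : Set X, A ∉ I ∧ κ = #A} (nonNumber I) :=
  ⟨csInf_mem ⟨_, univ, h, rfl⟩, fun _ hκ => csInf_le' hκ⟩

theorem isIntervalPartition_singletons : IsIntervalPartition (fun n => {n}) where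
  nonempty n := singleton_nonempty n
  interval n := ordConnected_singleton
  disjoint m n h := by simpa using h
  cover := by ext x; simp

theorem singleton_mem_meagerMinus (x : BairePt) : {x} ∈ meagerMinus := by
  refine ⟨fun n => x n + 1, fun n => {n}, isIntervalPartition_singletons, ?_⟩
  rintro y rfl
  refine Eventually.of_forall fun n h => ?_
  have := h (mem_singleton n)
  simp at this

theorem univ_notMem_meagerMinus : univ ∉ meagerMinus := by
  rintro ⟨z, I, -, h⟩
  obtain ⟨n, hn⟩ := (h (mem_univ z)).exists
  exact hn (eqOn_refl z _)

theorem singleton_mem_meagerIdeal (x : BairePt) : {x} ∈ meagerIdeal := by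
  have hd : IsNowhereDense ({x} : Set BairePt) := by
    rw [isClosed_singleton.isNowhereDense_iff, interior_eq_empty_iff_dense_compl]
    intro y
    rw [mem_closure_iff_seq_limit]
    refine ⟨fun k i => if i < k then y i else x i + 1, fun k hk => ?_, ?_⟩
    · have := congrFun hk k
      simp at this
    · rw [tendsto_pi_nhds]
      intro i
      refine tendsto_const_nhds.congr' ?_
      filter_upwards [eventually_gt_atTop i] with k hk
      simp [hk]
  exact hd.isMeagre

theorem univ_notMem_meagerIdeal : univ ∉ meagerIdeal :=
  not_isMeagre_of_isOpen isOpen_univ univ_nonempty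

/-! Since M_- ⊆ M, two inequalities are immediate. The others follow from a map `Φ` of two
variables: `Φ a b` escapes a meager F once a escapes some P ∈ M_- and b escapes some Q ∈ M_-
depending on a. For cov, choose a and then b; for non, the image of A × A under `Φ` is nonmeager.

To escape F it suffices that, for infinitely many m, x is bounded by m below m and copies a finite
block `h m` on [m, M m). Escaping P makes a infinitely often equal to H ∘ H, with H bounding the
blocks; iterating a then gives a sequence whose gaps infinitely often have room for a block.
Escaping Q makes b guess codes of the blocks at infinitely many of these gaps. -/

theorem IsIntervalPartition.eventually_subset_Ici {I : ℕ → Set ℕ} (hI : IsIntervalPartition I)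
    (k : ℕ) : ∀ᶠ n in atTop, I n ⊆ Ici k := by
  have h : ∀ j : ℕ, ∀ᶠ n in atTop, j ∉ I n := by
    intro j
    obtain ⟨m, hm⟩ := mem_iUnion.1 (hI.cover ▸ mem_univ j : j ∈ ⋃ n, I n)
    filter_upwards [eventually_gt_atTop m] with n hn hj
    exact disjoint_left.1 (hI.disjoint hn.ne) hm hj
  have h' := (Filter.eventually_all_finite (finite_Iio k)).2 fun j _ => h j
  filter_upwards [h'] with n hn j hj
  by_contra hlt
  exact hn j (by simpa using hlt) hj

/-- Some other piece lies wholly above a point of `I n`; by convexity `I n` cannot reach past it. -/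
theorem IsIntervalPartition.finite {I : ℕ → Set ℕ} (hI : IsIntervalPartition I) (n : ℕ) :
    (I n).Finite := by
  obtain ⟨a, ha⟩ := hI.nonempty n
  obtain ⟨m, hm, hnm⟩ :=
    ((hI.eventually_subset_Ici (a + 1)).and (eventually_gt_atTop n)).exists
  obtain ⟨c, hc⟩ := hI.nonempty m
  refine (finite_Iio c).subset fun d hd => ?_
  by_contra hcd
  have hac : a ≤ c := (Nat.le_succ a).trans (hm hc)
  exact disjoint_left.1 (hI.disjoint hnm.ne)
    ((hI.interval n).out ha hd ⟨hac, by simpa using hcd⟩) hc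

theorem isOpen_setOf_eqOn_of_finite (z : BairePt) {s : Set ℕ} (hs : s.Finite) :
    IsOpen {x : BairePt | EqOn x z s} := by
  have : {x : BairePt | EqOn x z s} = s.pi fun k => {z k} := by
    ext x
    simp [EqOn, Set.mem_pi]
  rw [this]
  exact isOpen_set_pi hs fun _ _ => isOpen_discrete _

theorem exists_eqOn_Iio_subset_of_isOpen {U : Set BairePt} (hU : IsOpen U) {y : BairePt}
    (hy : y ∈ U) : ∃ N, ∀ x : BairePt, EqOn x y (Iio N) → x ∈ U := by
  obtain ⟨s, u, hu, hsub⟩ := isOpen_pi_iff.1 hU y hy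
  refine ⟨s.sup id + 1, fun x hx => hsub fun k hk => ?_⟩
  have : k < s.sup id + 1 := Nat.lt_succ_of_le (Finset.le_sup (f := id) hk)
  rw [hx this]
  exact (hu k hk).2

theorem dense_of_forall_exists_eqOn_Iio {U : Set BairePt}
    (h : ∀ (y : BairePt) (N : ℕ), ∃ x ∈ U, EqOn x y (Iio N)) : Dense U := by
  rw [dense_iff_inter_open]
  rintro V hV ⟨y, hy⟩
  obtain ⟨N, hN⟩ := exists_eqOn_Iio_subset_of_isOpen hV hy
  obtain ⟨x, hx, hxy⟩ := h y N
  exact ⟨x, hN x hxy, hx⟩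

theorem Dense.exists_eqOn_Iio {U : Set BairePt} (hU : Dense U) (y : BairePt) (N : ℕ) :
    ∃ x ∈ U, EqOn x y (Iio N) := by
  obtain ⟨x, hx, hxU⟩ := hU.inter_open_nonempty _
    (isOpen_setOf_eqOn_of_finite y (finite_Iio N)) ⟨y, eqOn_refl y _⟩
  exact ⟨x, hxU, hx⟩

theorem meagerMinus_subset_meagerIdeal : meagerMinus ⊆ meagerIdeal := by
  rintro F ⟨z, I, hI, hF⟩
  have hmem : (⋂ N : ℕ, {x : BairePt | ∃ n ≥ N, EqOn x z (I n)}) ∈ residual BairePt := by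
    refine countable_iInter_mem.2 fun N => residual_of_dense_open ?_ ?_
    · have : {x : BairePt | ∃ n ≥ N, EqOn x z (I n)} =
          ⋃ n ≥ N, {x : BairePt | EqOn x z (I n)} := by
        ext x
        simp
      rw [this]
      exact isOpen_biUnion fun n _ => isOpen_setOf_eqOn_of_finite z (hI.finite n)
    · refine dense_of_forall_exists_eqOn_Iio fun y k => ?_
      obtain ⟨n, hn, hNn⟩ := ((hI.eventually_subset_Ici k).and (eventually_ge_atTop N)).exists
      classical
      refine ⟨(I n).piecewise z y, ⟨n, hNn, piecewise_eqOn _ _ _⟩, fun j hj => ?_⟩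
      exact piecewise_eq_of_notMem _ _ _ fun h => not_le.2 (mem_Iio.1 hj) (mem_Ici.1 (hn h))
  refine mem_of_superset hmem fun x hx hxF => ?_
  obtain ⟨N, hN⟩ := eventually_atTop.1 (hF hxF)
  obtain ⟨n, hn, he⟩ := mem_iInter.1 hx N
  exact hN n hn he

/-! ### Finite blocks that force a point out of a meager set -/

theorem exists_antitone_dense_open_of_isMeagre {F : Set BairePt} (hF : IsMeagre F) :
    ∃ U : ℕ → Set BairePt, Antitone U ∧ (∀ n, IsOpen (U n)) ∧ (∀ n, Dense (U n)) ∧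
      Disjoint (⋂ n, U n) F := by
  obtain ⟨S, hSo, hSd, hSc, hSF⟩ := mem_residual_iff.1 hF
  have hne : (insert univ S).Nonempty := insert_nonempty _ _
  obtain ⟨V, hV⟩ := (hSc.insert univ).exists_eq_range hne
  have hVS : ∀ n, IsOpen (V n) ∧ Dense (V n) := by
    intro n
    rcases (hV ▸ mem_range_self n : V n ∈ insert univ S) with h | h
    · rw [h]
      exact ⟨isOpen_univ, dense_univ⟩
    · exact ⟨hSo _ h, hSd _ h⟩
  refine ⟨fun n => ⋂ i ∈ Iic n, V i, fun m n hmn =>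
      biInter_subset_biInter_left (Iic_subset_Iic.2 hmn),
    fun n => (finite_Iic n).isOpen_biInter fun i _ => (hVS i).1,
    fun n => dense_biInter_of_isOpen (fun i _ => (hVS i).1) (finite_Iic n).countable
      fun i _ => (hVS i).2, ?_⟩
  rw [disjoint_left]
  intro x hx hxF
  refine hSF (mem_sInter.2 fun T hT => ?_) hxF
  obtain ⟨n, rfl⟩ := (hV ▸ mem_insert_of_mem univ hT : T ∈ range V)
  exact mem_iInter₂.1 (mem_iInter.1 hx n) n (mem_Iic.2 le_rfl)

/-- A single finite extension forces finitely many initial segments into a dense open set. -/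
theorem exists_uniform_extension {U : Set BairePt} (hUo : IsOpen U) (hUd : Dense U) (m : ℕ)
    {S : Set BairePt} (hS : S.Finite) :
    ∃ (h : BairePt) (M : ℕ), ∀ s ∈ S, ∀ y : BairePt,
      EqOn y s (Iio m) → EqOn y h (Ico m M) → y ∈ U := by
  induction S, hS using Set.Finite.induction_on with
  | empty => exact ⟨0, 0, by simp⟩
  | @insert s S _ _ ih =>
    obtain ⟨h, M, hM⟩ := ih
    -- `q` prolongs the old block, so the segments already handled stay handled.
    obtain ⟨q, hqU, hq⟩ := hUd.exists_eqOn_Iio (fun k => if k < m then s k else h k) (max m M)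
    obtain ⟨N, hN⟩ := exists_eqOn_Iio_subset_of_isOpen hUo hqU
    refine ⟨q, max M N, ?_⟩
    rintro t (rfl | ht) y hyt hyq
    · refine hN y fun k hk => ?_
      rcases lt_or_ge k m with hkm | hkm
      · rw [hyt hkm, hq (lt_max_of_lt_left hkm)]
        exact (if_pos hkm).symm
      · exact hyq ⟨hkm, lt_max_of_lt_right hk⟩
    · refine hM t ht y hyt fun k hk => ?_
      rw [hyq ⟨hk.1, lt_max_of_lt_left hk.2⟩, hq (lt_max_of_lt_right hk.2)]
      exact if_neg (not_lt.2 hk.1)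

/-- Only finitely many segments of length m have all values below m, so one block serves them all.
-/
theorem exists_extension_of_bounded {U : Set BairePt} (hUo : IsOpen U) (hUd : Dense U) (m : ℕ) :
    ∃ (h : BairePt) (M : ℕ), ∀ y : BairePt,
      (∀ k < m, y k < m) → EqOn y h (Ico m M) → y ∈ U := by
  let e : (Fin m → Fin m) → BairePt := fun s k => if hk : k < m then s ⟨k, hk⟩ else 0
  obtain ⟨h, M, hM⟩ := exists_uniform_extension hUo hUd m (finite_range e)
  refine ⟨h, M, fun y hy => hM _ ⟨fun k => ⟨y k, hy k k.2⟩, rfl⟩ y fun k hk => ?_⟩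
  simp only [mem_Iio] at hk
  simp [e, hk]

theorem exists_extension_of_isMeagre {F : Set BairePt} (hF : IsMeagre F) :
    ∃ (h : ℕ → BairePt) (M H : ℕ → ℕ), Monotone H ∧ (∀ m, M m ≤ H m) ∧
      (∀ m, ∀ k < M m, h m k < H m) ∧
      ∀ x : BairePt, (∃ᶠ m in atTop, (∀ k < m, x k < m) ∧ EqOn x (h m) (Ico m (M m))) → x ∉ F := by
  obtain ⟨U, hanti, hUo, hUd, hUF⟩ := exists_antitone_dense_open_of_isMeagre hF
  choose h M hM using fun m => exists_extension_of_bounded (hUo m) (hUd m) m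
  let B : ℕ → ℕ := fun m => M m + ∑ k ∈ Finset.range (M m), (h m k + 1)
  let H : ℕ → ℕ := fun m => ∑ i ∈ Finset.range (m + 1), B i
  have hBH : ∀ m, B m ≤ H m := fun m =>
    Finset.single_le_sum (f := B) (fun _ _ => Nat.zero_le _) (Finset.self_mem_range_succ m)
  refine ⟨h, M, H, fun m n hmn => ?_, fun m => (Nat.le_add_right _ _).trans (hBH m),
    fun m k hk => ?_, fun x hx hxF => ?_⟩
  · exact Finset.sum_le_sum_of_subset (Finset.range_mono (by omega))
  · have : h m k + 1 ≤ ∑ k ∈ Finset.range (M m), (h m k + 1) :=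
      Finset.single_le_sum (f := fun k => h m k + 1) (fun _ _ => Nat.zero_le _)
        (Finset.mem_range.2 hk)
    exact (Nat.lt_of_succ_le this).trans_le ((Nat.le_add_left _ _).trans (hBH m))
  -- The `U n` decrease, so entering `U m` for infinitely many m means entering all of them.
  · refine disjoint_left.1 hUF (mem_iInter.2 fun n => ?_) hxF
    obtain ⟨m, hnm, hm⟩ := frequently_atTop.1 hx n
    exact hanti hnm (hM m x hm.1 hm.2)

/-! ### Fast sequences and gluing -/

/-- The strictly increasing sequence obtained by iterating the running sum of `a`. -/
def fastSeq (a : ℕ → ℕ) : ℕ → ℕ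
  | 0 => 0
  | n + 1 => fastSeq a n + 1 + ∑ i ∈ Finset.range (fastSeq a n + 1), a i

theorem fastSeq_strictMono (a : ℕ → ℕ) : StrictMono (fastSeq a) :=
  strictMono_nat_of_lt_succ fun n => by
    rw [fastSeq]
    omega

theorem exists_fastSeq_le_lt (a : ℕ → ℕ) (k : ℕ) :
    ∃ n, fastSeq a n ≤ k ∧ k < fastSeq a (n + 1) := by
  have h : ∃ n, k < fastSeq a (n + 1) := ⟨k, (fastSeq_strictMono a).le_apply⟩
  classical
  refine ⟨Nat.find h, ?_, Nat.find_spec h⟩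
  rcases hn : Nat.find h with _ | n
  · exact Nat.zero_le k
  · exact not_lt.1 (Nat.find_min h (hn ▸ Nat.lt_succ_self n))

theorem le_fastSeq_succ {a : ℕ → ℕ} {n i : ℕ} (h : i ≤ fastSeq a n) :
    a i ≤ fastSeq a (n + 1) := by
  rw [fastSeq]
  exact (Finset.single_le_sum (f := a) (fun _ _ => Nat.zero_le _)
    (Finset.mem_range.2 (Nat.lt_succ_of_le h))).trans (Nat.le_add_left _ _)

theorem frequently_le_fastSeq_succ {a H : ℕ → ℕ} (hH : Monotone H)
    (h : ∃ᶠ m in atTop, a m = H (H m)) :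
    ∃ᶠ n in atTop, H (fastSeq a n) ≤ fastSeq a (n + 1) := by
  rw [frequently_atTop]
  intro N
  obtain ⟨m, hm, ham⟩ := frequently_atTop.1 h (fastSeq a N)
  obtain ⟨n, hn, hn'⟩ := exists_fastSeq_le_lt a m
  have hNn : N ≤ n :=
    Nat.lt_succ_iff.1 ((fastSeq_strictMono a).lt_iff_lt.1 (hm.trans_lt hn'))
  -- If the gap containing m is too short, H ∘ H ensures that the next one is long enough.
  by_cases hc : H (fastSeq a n) ≤ fastSeq a (n + 1)
  · exact ⟨n, hNn, hc⟩
  · refine ⟨n + 1, hNn.trans (Nat.le_succ n), ?_⟩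
    calc H (fastSeq a (n + 1)) ≤ H (H (fastSeq a n)) := hH (not_le.1 hc).le
      _ ≤ H (H m) := hH (hH hn)
      _ = a m := ham.symm
      _ ≤ fastSeq a (n + 1 + 1) := le_fastSeq_succ hn'.le

/-- The index of the interval `[f n, f (n + 1))`, `f = fastSeq a`, containing `k`. -/
noncomputable def fastSeqIndex (a : ℕ → ℕ) (k : ℕ) : ℕ :=
  (exists_fastSeq_le_lt a k).choose

theorem fastSeqIndex_eq {a : ℕ → ℕ} {n k : ℕ} (h : fastSeq a n ≤ k)
    (h' : k < fastSeq a (n + 1)) : fastSeqIndex a k = n := by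
  obtain ⟨h₁, h₂⟩ := (exists_fastSeq_le_lt a k).choose_spec
  have hf := fastSeq_strictMono a
  exact le_antisymm (Nat.lt_succ_iff.1 (hf.lt_iff_lt.1 (h₁.trans_lt h')))
    (Nat.lt_succ_iff.1 (hf.lt_iff_lt.1 (h.trans_lt h₂)))

/-- Glue the blocks of the functions `D (b n)` on the intervals of `fastSeq a`, replacing by `0`
the values that are too large. -/
noncomputable def glue (D : ℕ → BairePt) (a b : BairePt) : BairePt := fun k =>
  if D (b (fastSeqIndex a k)) k < fastSeq a (fastSeqIndex a k + 1)
    then D (b (fastSeqIndex a k)) k else 0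

/-- Truncation secures this bound at every n, even where b guesses wrongly. -/
theorem glue_lt (D : ℕ → BairePt) (a b : BairePt) {n k : ℕ} (hk : k < fastSeq a n) :
    glue D a b k < fastSeq a n := by
  obtain ⟨h₁, -⟩ := (exists_fastSeq_le_lt a k).choose_spec
  have hf := fastSeq_strictMono a
  have hi : fastSeqIndex a k + 1 ≤ n := hf.lt_iff_lt.1 (h₁.trans_lt hk)
  unfold glue
  split_ifs with h
  · exact h.trans_le (hf.monotone hi)
  · exact (Nat.zero_le k).trans_lt hk

theorem glue_apply (D : ℕ → BairePt) {a b : BairePt} {n k : ℕ} (h : fastSeq a n ≤ k)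
    (h' : k < fastSeq a (n + 1)) (hD : D (b n) k < fastSeq a (n + 1)) :
    glue D a b k = D (b n) k := by
  simp only [glue, fastSeqIndex_eq h h', if_pos hD]

/-! ### Infinitely often equal points and the map `Φ` -/

theorem exists_isIntervalPartition_inter_nonempty {X : Set ℕ} (hX : X.Infinite) :
    ∃ I : ℕ → Set ℕ, IsIntervalPartition I ∧ ∀ n, (I n ∩ X).Nonempty := by
  let e : ℕ → ℕ := fun n => Nat.rec 0 (fun n _ => Nat.nth (· ∈ X) n + 1) n
  have hmem : ∀ n, Nat.nth (· ∈ X) n ∈ X := Nat.nth_mem_of_infinite hX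
  have hlt : ∀ n, e n ≤ Nat.nth (· ∈ X) n := by
    rintro (_ | n)
    · exact Nat.zero_le _
    · exact Nat.nth_strictMono hX (Nat.lt_succ_self n)
  have he : StrictMono e := strictMono_nat_of_lt_succ fun n => Nat.lt_succ_of_le (hlt n)
  have hin : ∀ n, Nat.nth (· ∈ X) n ∈ Ico (e n) (e (n + 1)) :=
    fun n => ⟨hlt n, Nat.lt_succ_self _⟩
  refine ⟨fun n => Ico (e n) (e (n + 1)), ⟨fun n => ⟨_, hin n⟩, fun n => ordConnected_Ico,
    he.monotone.pairwise_disjoint_on_Ico_succ, ?_⟩, fun n => ⟨_, hin n, hmem n⟩⟩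
  refine eq_univ_of_forall fun k => mem_iUnion.2 ?_
  have h : ∃ n, k < e (n + 1) := ⟨k, he.le_apply⟩
  refine ⟨Nat.find h, ?_, Nat.find_spec h⟩
  rcases hn : Nat.find h with _ | n
  · exact Nat.zero_le k
  · exact not_lt.1 (Nat.find_min h (hn ▸ Nat.lt_succ_self n))

/-- Every interval is chosen to meet X, so agreement on an interval gives agreement at a point of X.
-/
theorem exists_meagerMinus_frequently_eq {X : Set ℕ} (hX : X.Infinite) (z : BairePt) :
    ∃ P ∈ meagerMinus, ∀ x ∉ P, ∃ᶠ n in atTop, n ∈ X ∧ x n = z n := by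
  obtain ⟨I, hI, hIX⟩ := exists_isIntervalPartition_inter_nonempty hX
  refine ⟨_, ⟨z, I, hI, Subset.rfl⟩, fun x hx => frequently_atTop.2 fun N => ?_⟩
  have hx' : ∃ᶠ n in atTop, EqOn x z (I n) := by
    simpa [Filter.Frequently] using hx
  obtain ⟨n, hn, hN⟩ := (hx'.and_eventually (hI.eventually_subset_Ici N)).exists
  obtain ⟨k, hk, hkX⟩ := hIX n
  exact ⟨k, hN hk, hkX, hn hk⟩

/-- A point avoiding a given meager set can be computed from two points that successively avoid
sets in `M_-`. -/
theorem exists_avoid_meager_of_avoid_meagerMinus : ∃ Φ : BairePt → BairePt → BairePt,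
    ∀ F, IsMeagre F → ∃ P ∈ meagerMinus, ∀ a ∉ P, ∃ Q ∈ meagerMinus, ∀ b ∉ Q, Φ a b ∉ F := by
  let D : ℕ → BairePt := TopologicalSpace.denseSeq BairePt
  have hD : ∀ (h : BairePt) (N : ℕ), ∃ c, EqOn (D c) h (Iio N) := by
    intro h N
    obtain ⟨_, ⟨c, rfl⟩, hc⟩ :=
      Dense.exists_eqOn_Iio (TopologicalSpace.denseRange_denseSeq BairePt) h N
    exact ⟨c, hc⟩
  refine ⟨glue D, fun F hF => ?_⟩
  obtain ⟨h, M, H, hH, hMH, hhH, hx⟩ := exists_extension_of_isMeagre hF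
  choose c hc using fun m => hD (h m) (M m)
  obtain ⟨P, hP, hPa⟩ := exists_meagerMinus_frequently_eq infinite_univ fun m => H (H m)
  refine ⟨P, hP, fun a ha => ?_⟩
  have hfreq := frequently_le_fastSeq_succ hH ((hPa a ha).mono fun _ h => h.2)
  obtain ⟨Q, hQ, hQb⟩ := exists_meagerMinus_frequently_eq
    (Nat.frequently_atTop_iff_infinite.1 hfreq) fun n => c (fastSeq a n)
  refine ⟨Q, hQ, fun b hb => hx _ ?_⟩
  refine (fastSeq_strictMono a).tendsto_atTop.frequently ((hQb b hb).mono ?_)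
  rintro n ⟨hn : H (fastSeq a n) ≤ fastSeq a (n + 1), hbn⟩
  refine ⟨fun k hk => glue_lt D a b hk, fun k hk => ?_⟩
  have hDk : D (b n) k = h (fastSeq a n) k := by
    rw [hbn]
    exact hc _ hk.2
  -- At a long gap the block fits and its values are small enough to survive truncation.
  rw [glue_apply D hk.1 (hk.2.trans_le ((hMH _).trans hn))
    (hDk ▸ (hhH _ k hk.2).trans_le hn), hDk]

/-! ### Comparison of the cardinal invariants -/

theorem exists_forall_notMem_of_lt_covNumber {X ι : Type u} {J : Set (Set X)}
    (h : #ι < covNumber J) (P : ι → Set X) (hP : ∀ i, P i ∈ J) : ∃ x, ∀ i, x ∉ P i := by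
  by_contra! hc
  refine (h.trans_le ?_).false
  refine le_trans (csInf_le' ⟨range P, range_subset_iff.2 hP, ?_, rfl⟩) Cardinal.mk_range_le
  exact eq_univ_of_forall fun x => by simpa using hc x

theorem covNumber_meagerMinus_le : covNumber meagerMinus ≤ covNumber meagerIdeal := by
  obtain ⟨A, hA, hcov, hcard⟩ := (covNumber_isLeast singleton_mem_meagerIdeal).1
  rw [hcard]
  by_contra! hlt
  obtain ⟨Φ, hΦ⟩ := exists_avoid_meager_of_avoid_meagerMinus
  choose P hP hPa using fun F : A => hΦ F (hA F.2)
  obtain ⟨a, ha⟩ := exists_forall_notMem_of_lt_covNumber hlt P hP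
  choose Q hQ hQb using fun F : A => hPa F a (ha F)
  obtain ⟨b, hb⟩ := exists_forall_notMem_of_lt_covNumber hlt Q hQ
  obtain ⟨F, hF, hmem⟩ := mem_sUnion.1 (hcov ▸ mem_univ (Φ a b) : Φ a b ∈ ⋃₀ A)
  exact hQb ⟨F, hF⟩ b (hb _) hmem

theorem Set.Finite.isMeagre_baire {B : Set BairePt} (hB : B.Finite) : IsMeagre B := by
  rw [← biUnion_of_singleton B]
  exact isMeagre_biUnion hB.countable fun x _ => singleton_mem_meagerIdeal x

theorem le_nonNumber_meagerMinus : nonNumber meagerIdeal ≤ nonNumber meagerMinus := by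
  obtain ⟨A, hA, hcard⟩ := (nonNumber_isLeast univ_notMem_meagerMinus).1
  rw [hcard]
  obtain ⟨Φ, hΦ⟩ := exists_avoid_meager_of_avoid_meagerMinus
  have hmem : ∀ {P}, P ∈ meagerMinus → ∃ x ∈ A, x ∉ P := by
    rintro P ⟨z, I, hI, hP⟩
    by_contra! hc
    exact hA ⟨z, I, hI, Subset.trans hc hP⟩
  have hB : ¬ IsMeagre (image2 Φ A A) := by
    intro hm
    obtain ⟨P, hP, hPa⟩ := hΦ _ hm
    obtain ⟨a, haA, ha⟩ := hmem hP
    obtain ⟨Q, hQ, hQb⟩ := hPa a ha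
    obtain ⟨b, hbA, hb⟩ := hmem hQ
    exact hQb b hb (mem_image2_of_mem haA hbA)
  -- Infinitude of A is needed for |A|·|A| = |A|.
  have hinf : A.Infinite := fun hfin => hB (hfin.image2 Φ hfin).isMeagre_baire
  have : Infinite A := hinf.to_subtype
  calc nonNumber meagerIdeal ≤ #(image2 Φ A A) := csInf_le' ⟨_, hB, rfl⟩
    _ ≤ #A * #A := Cardinal.mk_image2_le
    _ = #A := Cardinal.mul_eq_self (Cardinal.aleph0_le_mk A)

theorem mainTheorem3 :
    covNumber meagerMinus = covNumber meagerIdeal ∧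
      nonNumber meagerMinus = nonNumber meagerIdeal := by
  refine ⟨le_antisymm covNumber_meagerMinus_le ?_, le_antisymm ?_ le_nonNumber_meagerMinus⟩
  · obtain ⟨A, hA, hcov, hcard⟩ := (covNumber_isLeast singleton_mem_meagerMinus).1
    exact csInf_le' ⟨A, hA.trans meagerMinus_subset_meagerIdeal, hcov, hcard⟩
  · obtain ⟨A, hA, hcard⟩ := (nonNumber_isLeast univ_notMem_meagerIdeal).1
    exact csInf_le' ⟨A, fun h => hA (meagerMinus_subset_meagerIdeal h), hcard⟩
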